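/- Let $F_2$ denote the free group of rank $2$, and let Stallings' group $S$ be the kernel of the homomorphism $F(\alpha,\beta)\times F(\gamma,\delta)\times F(\epsilon,\zeta)\to\mathbb{Z}$ from the product of three free groups of rank $2$ that sends each of the six generators to $1$. For a finite presentation $\langle \mathcal{A}\mid\mathcal{R}\rangle$, a word may be changed by free reductions, by free expansions, and by applications of a relator, i.e. $\alpha u\beta\mapsto\alpha v\beta$ where a cyclic conjugate of $uv^{-1}$ is in $\mathcal{R}^{\pm1}$. For a word $w$ representing $1$, $\mathrm{Area}(w)$ is the minimal number of relator applications in a sequence of such moves converting $w$ to the empty word, and the Dehn function is $\delta(n)=\max\{\mathrm{Area}(w)\mid w \text{ represents } 1,\ \ell(w)\le n\}$. For $f,g:\mathbb{N}\to\mathbb{N}$ write $f\preceq g$ when there is an integer $C>0$ with $f(n)\le C\,g(Cn+C)+Cn+C$ for all $n\in\mathbb{N}$, and $f\simeq g$ when $f\preceq g$ and $g\preceq f$. Theorem. The Dehn function of Stallings' group is quadratic. That is, the Dehn function of every finite presentation of $S$ is equivalent ($\simeq$) to $n\mapsto n^2$. In particular, with $[x,y]=x^{-1}y^{-1}xy$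 and $x^y=y^{-1}xy$, $$\langle a,b,c,d,s \mid [a,c],[a,d],[b,c],[b,d],\ s^a=s^b=s^c=s^d\rangle$$ (where the last item stands for the six relators $s^x(s^y)^{-1}$, for the pairs $(x,y)=(a,b),(a,c),(a,d),(b,c),(b,d),(c,d)$) is a presentation of $S$, via $a=\epsilon\alpha^{-1}$, $b=\epsilon\beta^{-1}$, $c=\epsilon\gamma^{-1}$, $d=\epsilon\delta^{-1}$, $s=\zeta\epsilon^{-1}$, and its Dehn function is equivalent to $n\mapsto n^2$. -/

import Mathlib

namespace Stallings

/-! ### Words, cost, area and Dehn functions -/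

/-- Words on the letters `x^{±1}`, `x : α`; `(x, true)` is the letter `x`, and `(x, false)` is the
letter `x⁻¹`.  Words are not assumed to be reduced. -/
abbrev Word (α : Type*) := List (α × Bool)

variable {α : Type*}

/-- The relator `r` of a presentation, up to inversion and cyclic conjugation, is the word `w`. -/
def IsConjRelator (R : Set (Word α)) (w : Word α) : Prop :=
  ∃ r ∈ R, w ~r r ∨ w ~r FreeGroup.invRev r

/-- One application of a relator: `p u q ↦ p v q`, where a cyclic conjugate of the word `u v⁻¹` is
in `R^{±1}`. -/
def ApplyRelator (R : Set (Word α)) (w w' : Word α) : Prop :=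
  ∃ p u v q : Word α, w = p ++ u ++ q ∧ w' = p ++ v ++ q ∧
    IsConjRelator R (u ++ FreeGroup.invRev v)

/-- `Converts R w m w'`: there is a sequence of free reductions, free expansions and applications
of relators that leads from `w` to `w'`, in which exactly `m` moves are applications of a
relator. -/
inductive Converts (R : Set (Word α)) : Word α → ℕ → Word α → Prop
  | refl (w : Word α) : Converts R w 0 w
  | reduce {w w' w'' : Word α} {m : ℕ} :
      Converts R w m w' → FreeGroup.Red.Step w' w'' → Converts R w m w''
  | expand {w w' w'' : Word α} {m : ℕ} :
      Converts R w m w' → FreeGroup.Red.Step w'' w' → Converts R w m w''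
  | relator {w w' w'' : Word α} {m : ℕ} :
      Converts R w m w' → ApplyRelator R w' w'' → Converts R w (m + 1) w''

/-- The word `w` represents the identity of the group `⟨α | R⟩`. -/
def NullHomotopic (R : Set (Word α)) (w : Word α) : Prop :=
  FreeGroup.mk w ∈ Subgroup.normalClosure (FreeGroup.mk '' R)

/-- The area of a null-homotopic word: the least cost of a conversion to the empty word. -/
noncomputable def area (R : Set (Word α)) (w : Word α) : ℕ :=
  sInf {m | Converts R w m []}

/-- The Dehn function of `⟨α | R⟩`: the largest area of a null-homotopic word of length at
most `n`. -/
noncomputable def dehnFunction (R : Set (Word α)) (n : ℕ) : ℕ :=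
  sSup {m | ∃ w : Word α, NullHomotopic R w ∧ w.length ≤ n ∧ area R w = m}

/-- `f ≼ g` for functions `ℕ → ℕ`. -/
def Dominated (f g : ℕ → ℕ) : Prop :=
  ∃ C : ℕ, 0 < C ∧ ∀ n : ℕ, f n ≤ C * g (C * n + C) + C * n + C

/-- `f ≃ g` for functions `ℕ → ℕ`. -/
def Equivalent (f g : ℕ → ℕ) : Prop :=
  Dominated f g ∧ Dominated g f

/-- `⟨α | R⟩` is a presentation of the group `G`, where the generator `x : α` stands for
the element `f x` of `G`. -/
def IsPresentation {G : Type*} [Group G] (R : Set (Word α)) (f : α → G) : Prop :=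
  Function.Surjective (FreeGroup.lift f) ∧
    (FreeGroup.lift f).ker = Subgroup.normalClosure (FreeGroup.mk '' R)

/-! ### The minimum and the maximum above are attained -/

theorem Converts.trans {R : Set (Word α)} {u v w : Word α} {m n : ℕ}
    (h : Converts R u m v) (h' : Converts R v n w) : Converts R u (m + n) w := by
  induction h' with
  | refl => exact h
  | reduce _ s ih => exact ih.reduce s
  | expand _ s ih => exact ih.expand s
  | relator _ s ih => exact ih.relator s

theorem Converts.context {R : Set (Word α)} {u v : Word α} {m : ℕ} (p q : Word α)
    (h : Converts R u m v) : Converts R (p ++ u ++ q) m (p ++ v ++ q) := by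
  have key : ∀ {x y : Word α}, FreeGroup.Red.Step x y →
      FreeGroup.Red.Step (p ++ x ++ q) (p ++ y ++ q) := fun s =>
    (FreeGroup.Red.Step.append_left s).append_right
  induction h with
  | refl => exact Converts.refl _
  | reduce _ s ih => exact ih.reduce (key s)
  | expand _ s ih => exact ih.expand (key s)
  | relator _ s ih =>
    obtain ⟨p', x, y, q', rfl, rfl, hr⟩ := s
    exact ih.relator ⟨p ++ p', x, y, q' ++ q, by simp, by simp, hr⟩

theorem ApplyRelator.symm {R : Set (Word α)} {u v : Word α} (h : ApplyRelator R u v) :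
    ApplyRelator R v u := by
  obtain ⟨p, x, y, q, rfl, rfl, r, hr, h⟩ := h
  have key : ∀ {z : Word α}, (x ++ FreeGroup.invRev y) ~r z →
      (y ++ FreeGroup.invRev x) ~r FreeGroup.invRev z := by
    intro z hz
    have := (hz.map (fun g : α × Bool => (g.1, !g.2))).reverse
    simpa [FreeGroup.invRev, Function.comp_def] using this
  refine ⟨p, y, x, q, rfl, rfl, r, hr, ?_⟩
  rcases h with h | h
  · exact Or.inr (key h)
  · exact Or.inl (by simpa using key h)

theorem Converts.symm {R : Set (Word α)} {u v : Word α} {m : ℕ} (h : Converts R u m v) :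
    Converts R v m u := by
  induction h with
  | refl => exact Converts.refl _
  | reduce _ s ih => simpa using ((Converts.refl _).expand s).trans ih
  | expand _ s ih => simpa using ((Converts.refl _).reduce s).trans ih
  | relator _ s ih =>
    have := ((Converts.refl _).relator s.symm).trans ih
    rwa [Nat.zero_add, Nat.add_comm] at this

theorem Converts.of_red {R : Set (Word α)} {u v : Word α} (h : FreeGroup.Red u v) :
    Converts R u 0 v := by
  induction h with
  | refl => exact Converts.refl _
  | tail _ s ih => exact ih.reduce s

theorem Converts.of_mk_eq {R : Set (Word α)} {u v : Word α}
    (h : FreeGroup.mk u = FreeGroup.mk v) : Converts R u 0 v := by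
  obtain ⟨w, hu, hv⟩ := FreeGroup.Red.exact.1 h
  exact (Converts.of_red hu).trans (Converts.of_red hv).symm

/-- Every null-homotopic word can be converted to the empty word. -/
theorem NullHomotopic.exists_converts {R : Set (Word α)} {w : Word α} (h : NullHomotopic R w) :
    ∃ m, Converts R w m [] := by
  suffices H : ∀ g ∈ Subgroup.normalClosure (FreeGroup.mk '' R), ∃ w : Word α, ∃ m,
      FreeGroup.mk w = g ∧ Converts R w m [] by
    obtain ⟨v, m, hv, hm⟩ := H _ h
    exact ⟨_, (Converts.of_mk_eq hv.symm).trans hm⟩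
  intro g hg
  induction hg using Subgroup.closure_induction with
  | mem x hx =>
    obtain ⟨_, ⟨r, hr, rfl⟩, hx⟩ := Group.mem_conjugatesOfSet_iff.1 hx
    obtain ⟨g, rfl⟩ := isConj_iff.1 hx
    obtain ⟨p, rfl⟩ : ∃ p, FreeGroup.mk p = g := Quot.exists_rep g
    have hu : Converts R r (0 + 1) [] :=
      (Converts.refl r).relator ⟨[], r, [], [], by simp, by simp, r, hr, Or.inl (by
        simp [FreeGroup.invRev, List.IsRotated.refl])⟩
    refine ⟨p ++ r ++ FreeGroup.invRev p, 0 + 1 + 0, ?_,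
      (hu.context p (FreeGroup.invRev p)).trans (Converts.of_mk_eq ?_)⟩
    · rw [← FreeGroup.mul_mk, ← FreeGroup.mul_mk, ← FreeGroup.inv_mk]
    · rw [List.append_nil, ← FreeGroup.mul_mk, ← FreeGroup.inv_mk, mul_inv_cancel,
        FreeGroup.one_eq_mk]
  | one => exact ⟨[], 0, rfl, Converts.refl _⟩
  | mul x y _ _ hx hy =>
    obtain ⟨u, m, rfl, hu⟩ := hx
    obtain ⟨v, n, rfl, hv⟩ := hy
    refine ⟨u ++ v, m + n, by simp, Converts.trans ?_ hv⟩
    simpa using hu.context [] v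
  | inv x _ hx =>
    obtain ⟨u, m, rfl, hu⟩ := hx
    refine ⟨FreeGroup.invRev u, m + 0, by simp, ?_⟩
    have h1 : Converts R (FreeGroup.invRev u) m (FreeGroup.invRev u ++ u) := by
      simpa using hu.symm.context (FreeGroup.invRev u) []
    refine h1.trans (Converts.of_mk_eq ?_)
    rw [← FreeGroup.mul_mk, ← FreeGroup.inv_mk, inv_mul_cancel, FreeGroup.one_eq_mk]

/-- The area is a minimum. -/
theorem NullHomotopic.area_isLeast {R : Set (Word α)} {w : Word α} (h : NullHomotopic R w) :
    IsLeast {m | Converts R w m []} (area R w) :=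
  ⟨Nat.sInf_mem h.exists_converts, fun _ hm => Nat.sInf_le hm⟩

/-- The Dehn function is a maximum. -/
theorem dehnFunction_isGreatest [Finite α] (R : Set (Word α)) (n : ℕ) :
    IsGreatest {m | ∃ w : Word α, NullHomotopic R w ∧ w.length ≤ n ∧ area R w = m}
      (dehnFunction R n) := by
  set s : Set ℕ := {m | ∃ w : Word α, NullHomotopic R w ∧ w.length ≤ n ∧ area R w = m}
  have hne : s.Nonempty := ⟨area R [], [], Subgroup.one_mem _, Nat.zero_le _, rfl⟩
  have hfin : s.Finite := by
    refine ((List.finite_length_le (α × Bool) n).image (area R)).subset ?_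
    rintro m ⟨w, _, hw, rfl⟩
    exact ⟨w, hw, rfl⟩
  exact ⟨Nat.sSup_mem hne hfin.bddAbove, fun _ hm => le_csSup hfin.bddAbove hm⟩

/-! ### Stallings' group -/

/-- The homomorphism from a rank-2 free group to `ℤ` that sends both generators to `1`. -/
def expSum : FreeGroup Bool →* Multiplicative ℤ :=
  FreeGroup.lift fun _ => Multiplicative.ofAdd 1

/-- Stallings' group: the kernel of the homomorphism from the product of three rank-2 free groups
to `ℤ` that sends all six generators to `1`. -/
def stallingsGroup : Subgroup (FreeGroup Bool × FreeGroup Bool × FreeGroup Bool) :=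
  (expSum.coprod (expSum.coprod expSum)).ker

/-- The symbols `a, b, c, d, s`. -/
inductive Gen
  | a | b | c | d | s
  deriving DecidableEq

/-- The word `[x,y] = x⁻¹ y⁻¹ x y`. -/
def commWord (x y : Gen) : Word Gen :=
  [(x, false), (y, false), (x, true), (y, true)]

/-- The word `s^x s^{-y} = (x⁻¹ s x) (y⁻¹ s⁻¹ y)`. -/
def conjWord (x y : Gen) : Word Gen :=
  [(x, false), (.s, true), (x, true), (y, false), (.s, false), (y, true)]

/-- The ten relators of `⟨a,b,c,d,s | [a,c], [a,d], [b,c], [b,d], s^a = s^b = s^c = s^d⟩`. -/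
def stallingsRelators : Set (Word Gen) :=
  {commWord .a .c, commWord .a .d, commWord .b .c, commWord .b .d,
    conjWord .a .b, conjWord .a .c, conjWord .a .d,
    conjWord .b .c, conjWord .b .d, conjWord .c .d}

/-- With `F(α,β) × F(γ,δ) × F(ε,ζ)` the product of free groups, where in each factor `false` is the
first generator and `true` the second, these are the elements
`a = εα⁻¹`, `b = εβ⁻¹`, `c = εγ⁻¹`, `d = εδ⁻¹`, `s = ζε⁻¹`. -/
def genValue : Gen → FreeGroup Bool × FreeGroup Bool × FreeGroup Bool
  | .a => ((FreeGroup.of false)⁻¹, 1, FreeGroup.of false)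
  | .b => ((FreeGroup.of true)⁻¹, 1, FreeGroup.of false)
  | .c => (1, (FreeGroup.of false)⁻¹, FreeGroup.of false)
  | .d => (1, (FreeGroup.of true)⁻¹, FreeGroup.of false)
  | .s => (1, 1, FreeGroup.of true * (FreeGroup.of false)⁻¹)

theorem genValue_mem (x : Gen) : genValue x ∈ stallingsGroup := by
  cases x <;> simp [genValue, stallingsGroup, expSum, MonoidHom.mem_ker]

/-- The elements of Stallings' group for which `a, b, c, d, s` stand. -/
def stallingsGen (x : Gen) : stallingsGroup :=
  ⟨genValue x, genValue_mem x⟩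

end Stallings

/-! The area of a word is studied in the free group, where it is the least number of conjugates
of relators and of their inverses whose product is the given element (`Fillable`); `Near R m g h`
says that `g` can be converted to `h` with at most `m` relators.

*Upper bound.* Write `S` for Stallings' group, and `F(α, β)`, `F(γ, δ)`, `F(ε, ζ)` for the three
free factors. A word in one factor lifts to `S` once a letter of another factor is chosen: if the
letter is `t`, replace each letter `x` by `x t⁻¹`. The words of two factors, lifted with the same
letter of the third, commute at quadratic cost, because the generators commute. The lifts of a
word of exponent sum zero with letters `t` and `t'` of two different factors agree at quadratic
cost (`near_pushThird`), because `t' t⁻¹` commutes with the generators. The normal form of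
`(p, q, r)` in `S` is `U V W`, where `U` and `V` are the lifts of `p` and `q` with the letter `ε`, and
`W` is the lift with `α` of a word of exponent sum zero, a power of `ε` times `r`. To multiply
two normal forms, `W` has to pass a lift `U'` and a lift `V'`. For `V'`, change its letter from
`ε` to `α`, which makes it commute with `W` and leaves behind a power of `ε α⁻¹`; that power only
conjugates `W`. For `U'`, first change the letter of `W` to `γ`, and do the same. So the product
of two normal forms is brought to normal form at quadratic cost (`near_normalForm_mul`). Halving
a word repeatedly, one brings a word of length `n` to normal form at a cost of `O(n²)`, because
`n² + 2 (n/2)² + 4 (n/4)² + ⋯` is at most `2 n²` (`near_normalForm`). For a word that represents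
`1` in `S` the normal form is empty, so this also proves that the ten relators present `S`.

*Lower bound.* The homomorphism `a, b ↦ X`, `c, d ↦ Y`, `s ↦ 1` to the Heisenberg group sends
every relator to the centre `ℤ`, with value `0` or `1`, and `[aⁿ, cⁿ]` to `n²`
(`sq_le_dehnFunction`).

*Other presentations.* The Dehn functions of finite presentations of a group dominate one another
(`IsPresentation.dominated`). -/

namespace Stallings

/-! ### Fillings in the free group -/

section Filling

variable {α β X : Type*} {R : Set (Word α)}

/-- The element `g` of the free group is a product of at most `m` conjugates of relators and of
inverses of relators.  For null-homotopic words this says that the area is at most `m`; it has the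
advantage that free reductions and expansions become equalities. -/
inductive Fillable (R : Set (Word α)) : ℕ → FreeGroup α → Prop
  | one (m : ℕ) : Fillable R m 1
  | mul {m : ℕ} {g : FreeGroup α} {r : Word α} (x : FreeGroup α) (hr : r ∈ R)
      (h : Fillable R m g) : Fillable R (m + 1) (x * FreeGroup.mk r * x⁻¹ * g)
  | mul_inv {m : ℕ} {g : FreeGroup α} {r : Word α} (x : FreeGroup α) (hr : r ∈ R)
      (h : Fillable R m g) : Fillable R (m + 1) (x * (FreeGroup.mk r)⁻¹ * x⁻¹ * g)

namespace Fillable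

theorem mono {m n : ℕ} {g : FreeGroup α} (h : Fillable R m g) (hmn : m ≤ n) :
    Fillable R n g := by
  induction h generalizing n with
  | one => exact one n
  | mul x hr _ ih =>
    obtain ⟨n, rfl⟩ := Nat.exists_eq_add_of_le' (Nat.le_of_add_left_le hmn)
    exact (ih (by omega)).mul x hr
  | mul_inv x hr _ ih =>
    obtain ⟨n, rfl⟩ := Nat.exists_eq_add_of_le' (Nat.le_of_add_left_le hmn)
    exact (ih (by omega)).mul_inv x hr

theorem mul' {m n : ℕ} {g h : FreeGroup α} (hg : Fillable R m g) (hh : Fillable R n h) :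
    Fillable R (m + n) (g * h) := by
  induction hg with
  | one => simpa using hh.mono (Nat.le_add_left _ _)
  | mul x hr _ ih =>
    rw [mul_assoc, Nat.add_right_comm]
    exact ih.mul x hr
  | mul_inv x hr _ ih =>
    rw [mul_assoc, Nat.add_right_comm]
    exact ih.mul_inv x hr

theorem conj {m : ℕ} {g : FreeGroup α} (hg : Fillable R m g) (y : FreeGroup α) :
    Fillable R m (y * g * y⁻¹) := by
  induction hg with
  | one m => simpa using one m
  | @mul m g r x hr _ ih =>
    convert ih.mul (y * x) hr using 1
    group
  | @mul_inv m g r x hr _ ih =>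
    convert ih.mul_inv (y * x) hr using 1
    group

theorem of_mem {r : Word α} (hr : r ∈ R) : Fillable R 1 (FreeGroup.mk r) := by
  simpa using (one (R := R) 0).mul 1 hr

theorem of_mem_inv {r : Word α} (hr : r ∈ R) : Fillable R 1 (FreeGroup.mk r)⁻¹ := by
  simpa using (one (R := R) 0).mul_inv 1 hr

theorem inv {m : ℕ} {g : FreeGroup α} (hg : Fillable R m g) : Fillable R m g⁻¹ := by
  induction hg with
  | one m => simpa using one m
  | @mul m g r x hr _ ih =>
    convert ih.mul' ((of_mem_inv hr).conj x) using 1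
    group
  | @mul_inv m g r x hr _ ih =>
    convert ih.mul' ((of_mem hr).conj x) using 1
    group

theorem of_isConjRelator {w : Word α} (hw : IsConjRelator R w) :
    Fillable R 1 (FreeGroup.mk w) := by
  have key : ∀ {w r : Word α}, w ~r r → Fillable R 1 (FreeGroup.mk r) →
      Fillable R 1 (FreeGroup.mk w) := by
    rintro w r ⟨n, rfl⟩ h
    rw [List.rotate_eq_drop_append_take_mod, ← FreeGroup.mul_mk] at h
    rw [← List.take_append_drop (n % w.length) w, ← FreeGroup.mul_mk]
    convert h.conj (FreeGroup.mk (w.take (n % w.length))) using 1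
    group
  obtain ⟨r, hr, h | h⟩ := hw
  · exact key h (of_mem hr)
  · refine key h ?_
    rw [← FreeGroup.inv_mk]
    exact of_mem_inv hr

theorem of_converts {u v : Word α} {m : ℕ} (h : Converts R u m v) :
    Fillable R m (FreeGroup.mk u * (FreeGroup.mk v)⁻¹) := by
  have step : ∀ {x y : Word α}, FreeGroup.Red.Step x y → FreeGroup.mk x = FreeGroup.mk y :=
    fun s => Quot.sound s
  induction h with
  | refl => rw [mul_inv_cancel]; exact one 0
  | reduce _ s ih => rwa [← step s]
  | expand _ s ih => rwa [step s]
  | relator _ s ih =>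
    obtain ⟨p, x, y, q, rfl, rfl, hr⟩ := s
    convert ih.mul' ((of_isConjRelator hr).conj (FreeGroup.mk p)) using 1
    simp only [← FreeGroup.mul_mk, ← FreeGroup.inv_mk]
    group

theorem exists_converts {m : ℕ} {w : Word α} (h : Fillable R m (FreeGroup.mk w)) :
    ∃ k ≤ m, Converts R w k [] := by
  have relator : ∀ {r : Word α}, IsConjRelator R r → Converts R r 1 [] := fun {r} hr =>
    (Converts.refl r).relator ⟨[], r, [], [], by simp, by simp, by simpa [FreeGroup.invRev]⟩
  have key : ∀ {r p w v : Word α} {k : ℕ}, IsConjRelator R r → Converts R v k [] →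
      FreeGroup.mk w =
        FreeGroup.mk p * FreeGroup.mk r * (FreeGroup.mk p)⁻¹ * FreeGroup.mk v →
      Converts R w (k + 1) [] := by
    intro r p w v k hr hv hw
    have h1 : Converts R w 0 (p ++ r ++ (FreeGroup.invRev p ++ v)) :=
      Converts.of_mk_eq (by simp [hw, ← FreeGroup.mul_mk, ← FreeGroup.inv_mk, mul_assoc])
    have h2 := (relator hr).context p (FreeGroup.invRev p ++ v)
    have h3 : Converts R (p ++ [] ++ (FreeGroup.invRev p ++ v)) 0 v :=
      Converts.of_mk_eq (by simp [← FreeGroup.mul_mk, ← FreeGroup.inv_mk])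
    have := ((h1.trans h2).trans h3).trans hv
    rwa [show 0 + 1 + 0 + k = k + 1 by omega] at this
  generalize hg : FreeGroup.mk w = g at h
  induction h generalizing w with
  | one m => exact ⟨0, Nat.zero_le _, Converts.of_mk_eq hg⟩
  | @mul m g r x hr _ ih =>
    obtain ⟨p, rfl⟩ : ∃ p, FreeGroup.mk p = x := Quot.exists_rep x
    obtain ⟨v, rfl⟩ : ∃ v, FreeGroup.mk v = g := Quot.exists_rep g
    obtain ⟨k, hk, h⟩ := ih rfl
    exact ⟨k + 1, by omega, key ⟨r, hr, Or.inl (List.IsRotated.refl _)⟩ h hg⟩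
  | @mul_inv m g r x hr _ ih =>
    obtain ⟨p, rfl⟩ : ∃ p, FreeGroup.mk p = x := Quot.exists_rep x
    obtain ⟨v, rfl⟩ : ∃ v, FreeGroup.mk v = g := Quot.exists_rep g
    obtain ⟨k, hk, h⟩ := ih rfl
    exact ⟨k + 1, by omega, key (p := p) ⟨r, hr, Or.inr (List.IsRotated.refl _)⟩ h
      (by rw [hg, FreeGroup.inv_mk])⟩

theorem area_le {m : ℕ} {w : Word α} (h : Fillable R m (FreeGroup.mk w)) : area R w ≤ m := by
  obtain ⟨k, hk, hw⟩ := h.exists_converts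
  exact (Nat.sInf_le hw).trans hk

theorem mem_normalClosure {m : ℕ} {g : FreeGroup α} (h : Fillable R m g) :
    g ∈ Subgroup.normalClosure (FreeGroup.mk '' R) := by
  have mem : ∀ {r : Word α}, r ∈ R →
      FreeGroup.mk r ∈ Subgroup.normalClosure (FreeGroup.mk '' R) := fun hr =>
    Subgroup.subset_normalClosure ⟨_, hr, rfl⟩
  induction h with
  | one => exact one_mem _
  | mul x hr _ ih => exact mul_mem (Subgroup.normalClosure_normal.conj_mem _ (mem hr) x) ih
  | mul_inv x hr _ ih =>
    exact mul_mem (Subgroup.normalClosure_normal.conj_mem _ (inv_mem (mem hr)) x) ih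

/-- If a homomorphism of free groups sends each relator to an element that is filled by `K`
relators, then it multiplies areas by at most `K`. -/
theorem map {R' : Set (Word β)} {K m : ℕ} (φ : FreeGroup α →* FreeGroup β)
    (hφ : ∀ r ∈ R, Fillable R' K (φ (FreeGroup.mk r))) {g : FreeGroup α} (h : Fillable R m g) :
    Fillable R' (K * m) (φ g) := by
  induction h with
  | one m => simpa using one _
  | mul x hr _ ih =>
    rw [Nat.mul_add_one, Nat.add_comm, map_mul, map_mul, map_mul, map_inv]
    exact ((hφ _ hr).conj _).mul' ih
  | mul_inv x hr _ ih =>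
    rw [Nat.mul_add_one, Nat.add_comm, map_mul, map_mul, map_mul, map_inv, map_inv]
    exact ((hφ _ hr).inv.conj _).mul' ih

end Fillable

theorem NullHomotopic.fillable_area {w : Word α} (h : NullHomotopic R w) :
    Fillable R (area R w) (FreeGroup.mk w) := by
  simpa [← FreeGroup.one_eq_mk] using Fillable.of_converts h.area_isLeast.1

theorem exists_fillable {g : FreeGroup α}
    (h : g ∈ Subgroup.normalClosure (FreeGroup.mk '' R)) : ∃ m, Fillable R m g := by
  obtain ⟨w, rfl⟩ : ∃ w, FreeGroup.mk w = g := Quot.exists_rep g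
  exact ⟨_, NullHomotopic.fillable_area h⟩

/-- `g` can be converted to `h` with at most `m` applications of a relator. -/
def Near (R : Set (Word α)) (m : ℕ) (g h : FreeGroup α) : Prop :=
  Fillable R m (g * h⁻¹)

namespace Near

theorem refl (m : ℕ) (g : FreeGroup α) : Near R m g g := by
  simpa [Near] using Fillable.one m

theorem of_eq {g h : FreeGroup α} (m : ℕ) (e : g = h) : Near R m g h := e ▸ refl m g

theorem mono {m n : ℕ} {g h : FreeGroup α} (H : Near R m g h) (hmn : m ≤ n) : Near R n g h :=
  Fillable.mono H hmn

theorem trans {m n : ℕ} {g h k : FreeGroup α} (H : Near R m g h) (H' : Near R n h k) :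
    Near R (m + n) g k := by
  rw [Near]
  convert Fillable.mul' H H' using 1
  group

theorem symm {m : ℕ} {g h : FreeGroup α} (H : Near R m g h) : Near R m h g := by
  rw [Near]
  convert Fillable.inv H using 1
  group

theorem mul {m n : ℕ} {g h g' h' : FreeGroup α} (H : Near R m g h) (H' : Near R n g' h') :
    Near R (m + n) (g * g') (h * h') := by
  rw [Near, Nat.add_comm]
  convert (Fillable.conj H' g).mul' H using 1
  group

theorem mul_left {m : ℕ} {g h : FreeGroup α} (x : FreeGroup α) (H : Near R m g h) :
    Near R m (x * g) (x * h) := by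
  simpa using (refl 0 x).mul H

theorem mul_right {m : ℕ} {g h : FreeGroup α} (H : Near R m g h) (x : FreeGroup α) :
    Near R m (g * x) (h * x) :=
  H.mul (refl 0 x)

theorem inv {m : ℕ} {g h : FreeGroup α} (H : Near R m g h) : Near R m g⁻¹ h⁻¹ := by
  rw [Near]
  convert (Fillable.conj (Near.symm H) g⁻¹) using 1
  group

end Near

/-- `g * h` can be converted to `h * g` with at most `m` applications of a relator. -/
abbrev NearlyCommute (R : Set (Word α)) (m : ℕ) (g h : FreeGroup α) : Prop :=
  Near R m (g * h) (h * g)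

namespace NearlyCommute

theorem mul_right {m n : ℕ} {g h k : FreeGroup α} (H : NearlyCommute R m g h)
    (H' : NearlyCommute R n g k) : NearlyCommute R (m + n) g (h * k) := by
  have h1 := Near.mul_right H k
  have h2 := Near.mul_left h H'
  simp only [NearlyCommute, ← mul_assoc] at h1 h2 ⊢
  exact h1.trans h2

theorem inv_right {m : ℕ} {g h : FreeGroup α} (H : NearlyCommute R m g h) :
    NearlyCommute R m g h⁻¹ := by
  have := (Near.symm H).mul_left h⁻¹ |>.mul_right h⁻¹
  simpa [mul_assoc] using this

theorem symm {m : ℕ} {g h : FreeGroup α} (H : NearlyCommute R m g h) :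
    NearlyCommute R m h g :=
  Near.symm H

theorem pow_right {m : ℕ} {g h : FreeGroup α} (H : NearlyCommute R m g h) (k : ℕ) :
    NearlyCommute R (m * k) g (h ^ k) := by
  induction k with
  | zero => exact Near.of_eq 0 (by simp)
  | succ k ih => exact pow_succ h k ▸ ih.mul_right H

end NearlyCommute

/-- To commute past a word costs at most linearly in its length. -/
theorem nearlyCommute_map {K : ℕ} [DecidableEq X] {g : FreeGroup α}
    {φ : FreeGroup X →* FreeGroup α} (h : ∀ i, NearlyCommute R K g (φ (FreeGroup.of i)))
    (u : FreeGroup X) : NearlyCommute R (K * u.norm) g (φ u) := by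
  suffices H : ∀ L : Word X, NearlyCommute R (K * L.length) g (φ (FreeGroup.mk L)) by
    simpa [FreeGroup.norm, FreeGroup.mk_toWord] using H u.toWord
  intro L
  induction L with
  | nil => simpa [NearlyCommute, ← FreeGroup.one_eq_mk] using Near.refl 0 g
  | cons x L ih =>
    have hx : NearlyCommute R K g (φ (FreeGroup.mk [x])) := by
      obtain ⟨i, _ | _⟩ := x
      · have : FreeGroup.mk [(i, false)] = (FreeGroup.of i)⁻¹ := rfl
        rw [this, map_inv]
        exact (h i).inv_right
      · exact h i
    have e : FreeGroup.mk (x :: L) = FreeGroup.mk [x] * FreeGroup.mk L := by simp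
    rw [e, map_mul, List.length_cons, Nat.mul_add_one, Nat.add_comm]
    exact hx.mul_right ih

/-- Two commuting families of elements: the words in them commute at quadratic cost. -/
theorem nearlyCommute_map_map {K : ℕ} [DecidableEq X] {φ ψ : FreeGroup X →* FreeGroup α}
    (h : ∀ i j, NearlyCommute R K (φ (FreeGroup.of i)) (ψ (FreeGroup.of j)))
    (u v : FreeGroup X) : NearlyCommute R (K * u.norm * v.norm) (φ u) (ψ v) :=
  nearlyCommute_map (fun j => (nearlyCommute_map (fun i => (h i j).symm) u).symm) v

/-- If a family `φ` is the product of two families `ψ` and `θ` that commute with one another,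
then each word in `φ` separates into a word in `ψ` and a word in `θ` at quadratic cost. -/
theorem near_mul_map {K n : ℕ} [DecidableEq X] {φ ψ θ : FreeGroup X →* FreeGroup α}
    (hφ : ∀ i, Near R K (φ (FreeGroup.of i)) (ψ (FreeGroup.of i) * θ (FreeGroup.of i)))
    (h : ∀ i j, NearlyCommute R K (θ (FreeGroup.of i)) (ψ (FreeGroup.of j)))
    {u : FreeGroup X} (hu : u.norm ≤ n) : Near R (2 * K * n ^ 2) (φ u) (ψ u * θ u) := by
  suffices H : ∀ L : Word X, Near R (2 * K * L.length ^ 2) (φ (FreeGroup.mk L))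
      (ψ (FreeGroup.mk L) * θ (FreeGroup.mk L)) by
    have := H u.toWord
    rw [FreeGroup.mk_toWord] at this
    exact this.mono (Nat.mul_le_mul_left _ (Nat.pow_le_pow_left hu 2))
  intro L
  induction L with
  | nil => simpa [← FreeGroup.one_eq_mk] using Near.refl 0 1
  | cons x L ih =>
    have hx : Near R (K + K) (φ (FreeGroup.mk [x]))
        (ψ (FreeGroup.mk [x]) * θ (FreeGroup.mk [x])) := by
      obtain ⟨i, _ | _⟩ := x
      · have : FreeGroup.mk [(i, false)] = (FreeGroup.of i)⁻¹ := rfl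
        rw [this, map_inv, map_inv, map_inv]
        have h1 := (hφ i).inv
        rw [mul_inv_rev] at h1
        exact h1.trans ((h i i).inv_right.symm.inv_right.symm)
      · exact (hφ i).mono (Nat.le_add_left _ _)
    have hc : NearlyCommute R (K * L.length) (θ (FreeGroup.mk [x])) (ψ (FreeGroup.mk L)) := by
      have := (nearlyCommute_map_map h (FreeGroup.mk [x]) (FreeGroup.mk L))
      refine this.mono ?_
      have h1 : (FreeGroup.mk [x]).norm ≤ 1 := FreeGroup.norm_mk_le
      have h2 : (FreeGroup.mk L).norm ≤ L.length := FreeGroup.norm_mk_le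
      calc K * (FreeGroup.mk [x]).norm * (FreeGroup.mk L).norm ≤ K * 1 * L.length := by gcongr
        _ = K * L.length := by ring
    have e : FreeGroup.mk (x :: L) = FreeGroup.mk [x] * FreeGroup.mk L := by simp
    have h1 := hx.mul ih
    have h2 := (hc.mul_left (ψ (FreeGroup.mk [x]))).mul_right (θ (FreeGroup.mk L))
    rw [e, map_mul, map_mul, map_mul, List.length_cons]
    simp only [mul_assoc] at h1 h2 ⊢
    refine (h1.trans h2).mono ?_
    nlinarith

/-- Two homomorphisms that are close on the generators are close, at linear cost. -/
theorem near_map_map {K : ℕ} {φ ψ : FreeGroup X →* FreeGroup α}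
    (h : ∀ i, Near R K (φ (FreeGroup.of i)) (ψ (FreeGroup.of i))) (L : Word X) :
    Near R (K * L.length) (φ (FreeGroup.mk L)) (ψ (FreeGroup.mk L)) := by
  induction L with
  | nil => simpa [← FreeGroup.one_eq_mk] using Near.refl 0 1
  | cons x L ih =>
    have hx : Near R K (φ (FreeGroup.mk [x])) (ψ (FreeGroup.mk [x])) := by
      obtain ⟨i, _ | _⟩ := x
      · have : FreeGroup.mk [(i, false)] = (FreeGroup.of i)⁻¹ := rfl
        rw [this, map_inv, map_inv]
        exact (h i).inv
      · exact h i
    have e : FreeGroup.mk (x :: L) = FreeGroup.mk [x] * FreeGroup.mk L := by simp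
    rw [e, map_mul, map_mul, List.length_cons, Nat.mul_add_one, Nat.add_comm]
    exact hx.mul ih

end Filling

/-! ### Dehn functions of different presentations of a group -/

section Invariance

variable {α β : Type*}

theorem area_le_dehnFunction [Finite α] {R : Set (Word α)} {w : Word α} {n : ℕ}
    (h : NullHomotopic R w) (hn : w.length ≤ n) : area R w ≤ dehnFunction R n :=
  (dehnFunction_isGreatest R n).2 ⟨w, h, hn, rfl⟩

theorem dehnFunction_le [Finite α] {R : Set (Word α)} {n N : ℕ}
    (h : ∀ w : Word α, NullHomotopic R w → w.length ≤ n → area R w ≤ N) :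
    dehnFunction R n ≤ N := by
  obtain ⟨w, h1, h2, h3⟩ := (dehnFunction_isGreatest R n).1
  exact h3 ▸ h w h1 h2

theorem dehnFunction_mono [Finite α] (R : Set (Word α)) : Monotone (dehnFunction R) :=
  fun _ _ hmn => dehnFunction_le fun _ hw hl => area_le_dehnFunction hw (hl.trans hmn)

theorem Dominated.trans {f g h : ℕ → ℕ} (hh : Monotone h) (hfg : Dominated f g)
    (hgh : Dominated g h) : Dominated f h := by
  obtain ⟨C, hC, hf⟩ := hfg
  obtain ⟨D, hD, hg⟩ := hgh
  refine ⟨2 * C * D + C * C * D + C * D + C, by positivity, fun n => ?_⟩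
  set E := 2 * C * D + C * C * D + C * D + C with hE
  have h1 : h (D * (C * n + C) + D) ≤ h (E * n + E) := by
    refine hh ?_
    have : D ≤ C * D := Nat.le_mul_of_pos_left D hC
    nlinarith [Nat.zero_le (C * C * D * n), Nat.zero_le (C * D * n), Nat.zero_le (C * n),
      Nat.zero_le (C * C * D)]
  calc f n ≤ C * g (C * n + C) + C * n + C := hf n
    _ ≤ C * (D * h (D * (C * n + C) + D) + D * (C * n + C) + D) + C * n + C := by
        gcongr; exact hg _
    _ ≤ C * (D * h (E * n + E) + D * (C * n + C) + D) + C * n + C := by gcongr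
    _ = C * D * h (E * n + E) + (C * C * D + C) * n + (C * C * D + C * D + C) := by ring
    _ ≤ E * h (E * n + E) + E * n + E := by gcongr <;> rw [hE] <;> nlinarith

/-- The Dehn function of a finite presentation dominates that of every presentation of the group on
finitely many generators: to fill a word on the generators of the first presentation, rewrite it in
those of the second, fill it there, and translate the filling back. -/
theorem IsPresentation.dominated [Finite α] [Finite β] {G : Type*} [Group G]
    {R : Set (Word α)} {R' : Set (Word β)} {f : α → G} {f' : β → G}
    (h : IsPresentation R f) (h' : IsPresentation R' f') (hR' : R'.Finite) :
    Dominated (dehnFunction R) (dehnFunction R') := by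
  classical
  choose φ₀ hφ₀ using fun x => h'.1 (f x)
  choose ψ₀ hψ₀ using fun y => h.1 (f' y)
  have hφ : ∀ g, FreeGroup.lift f' (FreeGroup.lift φ₀ g) = FreeGroup.lift f g := by
    intro g
    have : (FreeGroup.lift f').comp (FreeGroup.lift φ₀) = FreeGroup.lift f := by
      ext x; simp [hφ₀]
    exact DFunLike.congr_fun this g
  have hψ : ∀ g, FreeGroup.lift f (FreeGroup.lift ψ₀ g) = FreeGroup.lift f' g := by
    intro g
    have : (FreeGroup.lift f).comp (FreeGroup.lift ψ₀) = FreeGroup.lift f' := by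
      ext x; simp [hψ₀]
    exact DFunLike.congr_fun this g
  obtain ⟨K₁, hK₁⟩ : ∃ K, ∀ r ∈ R', Fillable R K (FreeGroup.lift ψ₀ (FreeGroup.mk r)) := by
    have : ∀ r ∈ R', ∃ m, Fillable R m (FreeGroup.lift ψ₀ (FreeGroup.mk r)) := by
      intro r hr
      refine exists_fillable ?_
      rw [← h.2, MonoidHom.mem_ker, hψ, ← MonoidHom.mem_ker, h'.2]
      exact Subgroup.subset_normalClosure ⟨r, hr, rfl⟩
    choose! m hm using this
    obtain ⟨K, hK⟩ := (hR'.image m).bddAbove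
    exact ⟨K, fun r hr => (hm r hr).mono (hK ⟨r, hr, rfl⟩)⟩
  obtain ⟨K₂, hK₂⟩ : ∃ K, ∀ x, Near R K (FreeGroup.of x)
      (FreeGroup.lift ψ₀ (FreeGroup.lift φ₀ (FreeGroup.of x))) := by
    have : ∀ x, ∃ m, Near R m (FreeGroup.of x)
        (FreeGroup.lift ψ₀ (FreeGroup.lift φ₀ (FreeGroup.of x))) := by
      intro x
      refine exists_fillable ?_
      rw [← h.2, MonoidHom.mem_ker, map_mul, map_inv, hψ, hφ, mul_inv_cancel]
    choose m hm using this
    obtain ⟨K, hK⟩ := (Set.finite_range m).bddAbove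
    exact ⟨K, fun x => (hm x).mono (hK ⟨x, rfl⟩)⟩
  obtain ⟨ℓ, hℓ⟩ : ∃ ℓ, ∀ x, (φ₀ x).norm ≤ ℓ := by
    obtain ⟨K, hK⟩ := (Set.finite_range fun x => (φ₀ x).norm).bddAbove
    exact ⟨K, fun x => hK ⟨x, rfl⟩⟩
  have hlen : ∀ L : Word α, (FreeGroup.lift φ₀ (FreeGroup.mk L)).norm ≤ ℓ * L.length := by
    intro L
    induction L with
    | nil => simp [← FreeGroup.one_eq_mk]
    | cons x L ih =>
      have e : FreeGroup.mk (x :: L) = FreeGroup.mk [x] * FreeGroup.mk L := by simp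
      have hx : (FreeGroup.lift φ₀ (FreeGroup.mk [x])).norm ≤ ℓ := by
        obtain ⟨i, _ | _⟩ := x
        · simpa using hℓ i
        · simpa using hℓ i
      rw [e, map_mul, List.length_cons, Nat.mul_add_one, Nat.add_comm]
      exact (FreeGroup.norm_mul_le _ _).trans (Nat.add_le_add hx ih)
  refine ⟨K₁ + K₂ + ℓ + 1, by omega, fun n => dehnFunction_le fun w hw hn => ?_⟩
  set g := FreeGroup.lift φ₀ (FreeGroup.mk w)
  have hg : NullHomotopic R' g.toWord := by
    have : FreeGroup.mk w ∈ (FreeGroup.lift f).ker := by rw [h.2]; exact hw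
    rw [NullHomotopic, FreeGroup.mk_toWord, ← h'.2, MonoidHom.mem_ker, hφ]
    exact this
  have h1 := hg.fillable_area.map (FreeGroup.lift ψ₀) hK₁
  rw [FreeGroup.mk_toWord] at h1
  have h2 := near_map_map (φ := MonoidHom.id _)
    (ψ := (FreeGroup.lift ψ₀).comp (FreeGroup.lift φ₀)) hK₂ w
  have h3 : Fillable R (K₂ * w.length + K₁ * area R' g.toWord) (FreeGroup.mk w) := by
    convert Fillable.mul' h2 h1 using 1
    simp [g]
  have h4 : area R' g.toWord ≤
      dehnFunction R' ((K₁ + K₂ + ℓ + 1) * n + (K₁ + K₂ + ℓ + 1)) := by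
    refine area_le_dehnFunction hg ?_
    have : g.toWord.length ≤ ℓ * w.length := hlen w
    nlinarith [Nat.mul_le_mul_left ℓ hn, Nat.zero_le ((K₁ + K₂ + 1) * n)]
  refine h3.area_le.trans ?_
  have h5 : K₁ * area R' g.toWord ≤ (K₁ + K₂ + ℓ + 1) *
      dehnFunction R' ((K₁ + K₂ + ℓ + 1) * n + (K₁ + K₂ + ℓ + 1)) :=
    Nat.mul_le_mul (by omega) h4
  have h6 : K₂ * w.length ≤ (K₁ + K₂ + ℓ + 1) * n := Nat.mul_le_mul (by omega) hn
  omega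

end Invariance

/-! ### The lower bound -/

instance : Finite Gen :=
  Set.finite_univ_iff.1 (Set.Finite.subset
    (Set.toFinite {Gen.a, Gen.b, Gen.c, Gen.d, Gen.s}) fun x _ => by cases x <;> simp)

theorem finite_stallingsRelators : stallingsRelators.Finite := by
  unfold stallingsRelators
  exact Set.toFinite _

/-- The integral Heisenberg group: the upper unitriangular `3 × 3` matrices, with `x` and `y` beside
the diagonal and `z` in the corner. -/
@[ext]
structure Heisenberg where
  x : ℤ
  y : ℤ
  z : ℤ

namespace Heisenberg

instance : Mul Heisenberg := ⟨fun g h => ⟨g.x + h.x, g.y + h.y, g.z + h.z + g.x * h.y⟩⟩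
instance : One Heisenberg := ⟨⟨0, 0, 0⟩⟩
instance : Inv Heisenberg := ⟨fun g => ⟨-g.x, -g.y, -g.z + g.x * g.y⟩⟩

@[simp] theorem mul_def (g h : Heisenberg) :
    g * h = ⟨g.x + h.x, g.y + h.y, g.z + h.z + g.x * h.y⟩ := rfl
@[simp] theorem one_def : (1 : Heisenberg) = ⟨0, 0, 0⟩ := rfl
@[simp] theorem inv_def (g : Heisenberg) : g⁻¹ = ⟨-g.x, -g.y, -g.z + g.x * g.y⟩ := rfl

instance : Group Heisenberg :=
  Group.ofLeftAxioms (fun _ _ _ => by ext <;> simp <;> ring) (fun _ => by ext <;> simp)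
    (fun _ => by ext <;> simp)

theorem pow_x (k : ℕ) : (⟨1, 0, 0⟩ : Heisenberg) ^ k = ⟨k, 0, 0⟩ := by
  induction k with
  | zero => rfl
  | succ k ih => rw [pow_succ, ih]; ext <;> simp

theorem pow_y (k : ℕ) : (⟨0, 1, 0⟩ : Heisenberg) ^ k = ⟨0, k, 0⟩ := by
  induction k with
  | zero => rfl
  | succ k ih => rw [pow_succ, ih]; ext <;> simp

end Heisenberg

/-- The images of `a, b, c, d, s` in the Heisenberg group.  Every relator of Stallings' group goes
to the centre, with corner entry `0` or `1`. -/
def heisenbergGen : Gen → Heisenberg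
  | .a => ⟨1, 0, 0⟩
  | .b => ⟨1, 0, 0⟩
  | .c => ⟨0, 1, 0⟩
  | .d => ⟨0, 1, 0⟩
  | .s => ⟨0, 0, 0⟩

theorem lift_heisenbergGen_relator {r : Word Gen} (hr : r ∈ stallingsRelators) :
    ∃ z : ℤ, |z| ≤ 1 ∧ FreeGroup.lift heisenbergGen (FreeGroup.mk r) = ⟨0, 0, z⟩ := by
  simp only [stallingsRelators, Set.mem_insert_iff, Set.mem_singleton_iff] at hr
  rcases hr with rfl | rfl | rfl | rfl | rfl | rfl | rfl | rfl | rfl | rfl <;>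
    simp [commWord, conjWord, heisenbergGen]

theorem Fillable.heisenberg {m : ℕ} {g : FreeGroup Gen} (h : Fillable stallingsRelators m g) :
    ∃ z : ℤ, |z| ≤ m ∧ FreeGroup.lift heisenbergGen g = ⟨0, 0, z⟩ := by
  induction h with
  | one m => exact ⟨0, by simp, by simp⟩
  | mul x hr _ ih =>
    obtain ⟨z, hz, e⟩ := ih
    obtain ⟨z', hz', e'⟩ := lift_heisenbergGen_relator hr
    refine ⟨z' + z, ?_, ?_⟩
    · push_cast
      linarith [abs_add_le z' z]
    · rw [map_mul, map_mul, map_mul, map_inv, e, e']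
      ext <;> simp
      ring
  | mul_inv x hr _ ih =>
    obtain ⟨z, hz, e⟩ := ih
    obtain ⟨z', hz', e'⟩ := lift_heisenbergGen_relator hr
    refine ⟨-z' + z, ?_, ?_⟩
    · push_cast
      linarith [abs_add_le (-z') z, abs_neg z']
    · rw [map_mul, map_mul, map_mul, map_inv, map_inv, e, e']
      ext <;> simp
      ring

theorem nearlyCommute_of_commWord {x y : Gen} (h : commWord x y ∈ stallingsRelators) :
    NearlyCommute stallingsRelators 1 (FreeGroup.of x) (FreeGroup.of y) := by
  have h1 : Near stallingsRelators 1
      ((FreeGroup.of x)⁻¹ * (FreeGroup.of y)⁻¹ * FreeGroup.of x * FreeGroup.of y) 1 := by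
    rw [Near, inv_one, mul_one]
    exact Fillable.of_mem h
  simpa [mul_assoc] using h1.mul_left (FreeGroup.of y * FreeGroup.of x)

/-- The word `[aⁿ, cⁿ]` has length `4n`, and it goes to the central element `n²` of the
Heisenberg group, so its area is at least `n²`. -/
theorem sq_le_dehnFunction (n : ℕ) : n ^ 2 ≤ dehnFunction stallingsRelators (4 * n) := by
  let p (x : Gen) (e : Bool) : Word Gen := List.replicate n (x, e)
  let w : Word Gen := p .a false ++ p .c false ++ p .a true ++ p .c true
  have hpos : ∀ x, FreeGroup.mk (p x true) = FreeGroup.of x ^ n := fun x => by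
    rw [← FreeGroup.mk_toWord (x := FreeGroup.of x ^ n), FreeGroup.toWord_of_pow]
  have hneg : ∀ x, FreeGroup.mk (p x false) = (FreeGroup.of x ^ n)⁻¹ := fun x => by
    rw [← hpos, FreeGroup.inv_mk]
    simp [FreeGroup.invRev, p]
  have hmk : FreeGroup.mk w = (FreeGroup.of Gen.a ^ n)⁻¹ * (FreeGroup.of Gen.c ^ n)⁻¹ *
      FreeGroup.of Gen.a ^ n * FreeGroup.of Gen.c ^ n := by
    simp only [w, ← FreeGroup.mul_mk, hpos, hneg]
  have hw : NullHomotopic stallingsRelators w := by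
    have h1 := (nearlyCommute_of_commWord (x := .a) (y := .c)
      (by simp [stallingsRelators])).pow_right n |>.symm.pow_right n |>.symm
    have h2 := Near.mul_left (FreeGroup.of Gen.c ^ n * FreeGroup.of Gen.a ^ n)⁻¹ h1
    rw [inv_mul_cancel, Near, inv_one, mul_one] at h2
    rw [NullHomotopic, hmk, ← mul_inv_rev, mul_assoc]
    exact h2.mem_normalClosure
  have hlen : w.length = 4 * n := by simp [w, p]; ring
  obtain ⟨z, hz, e⟩ := hw.fillable_area.heisenberg
  have hz2 : z = (n : ℤ) ^ 2 := by
    rw [hmk] at e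
    simp only [map_mul, map_inv, map_pow, FreeGroup.lift_apply_of, heisenbergGen,
      Heisenberg.pow_x, Heisenberg.pow_y] at e
    have := congrArg Heisenberg.z e
    simp at this
    linarith
  rw [hz2, abs_of_nonneg (by positivity)] at hz
  exact (by exact_mod_cast hz : n ^ 2 ≤ area stallingsRelators w).trans
    (area_le_dehnFunction hw hlen.le)

/-! ### The exponent sum -/

section ExponentSum

/-- The exponent sum on the free group of rank two, as an integer. -/
def height (u : FreeGroup Bool) : ℤ :=
  (expSum u).toAdd

@[simp] theorem height_one : height 1 = 0 := by simp [height]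

@[simp] theorem height_of (i : Bool) : height (FreeGroup.of i) = 1 := by simp [height, expSum]

@[simp] theorem height_mul (u v : FreeGroup Bool) : height (u * v) = height u + height v := by
  simp [height]

@[simp] theorem height_inv (u : FreeGroup Bool) : height u⁻¹ = -height u := by simp [height]

@[simp] theorem height_zpow (u : FreeGroup Bool) (k : ℤ) : height (u ^ k) = k * height u := by
  simp [height]

theorem lift_const {G : Type*} [Group G] (q : G) (u : FreeGroup Bool) :
    FreeGroup.lift (fun _ => q) u = q ^ height u := by
  have : FreeGroup.lift (fun _ : Bool => q) = (zpowersHom G q).comp expSum := by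
    ext i; simp [expSum]
  rw [this]
  simp [height, zpowersHom_apply]

theorem natAbs_height_le (u : FreeGroup Bool) : (height u).natAbs ≤ u.norm := by
  suffices H : ∀ L : Word Bool, (height (FreeGroup.mk L)).natAbs ≤ L.length by
    simpa [FreeGroup.norm, FreeGroup.mk_toWord] using H u.toWord
  intro L
  induction L with
  | nil => simp [← FreeGroup.one_eq_mk]
  | cons x L ih =>
    have hx : (height (FreeGroup.mk [x])).natAbs ≤ 1 := by
      obtain ⟨i, _ | _⟩ := x <;> simp [height, expSum]
    have e : FreeGroup.mk (x :: L) = FreeGroup.mk [x] * FreeGroup.mk L := by simp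
    rw [e, height_mul, List.length_cons]
    omega

theorem norm_of_zpow_le (i : Bool) (k : ℤ) : (FreeGroup.of i ^ k).norm ≤ k.natAbs := by
  obtain ⟨n, rfl | rfl⟩ := k.eq_nat_or_neg <;> simp

/-- Conjugation by a power of the first generator of the free group of rank two. -/
def shift (j : ℤ) (u : FreeGroup Bool) : FreeGroup Bool :=
  FreeGroup.of false ^ j * u * (FreeGroup.of false ^ j)⁻¹

@[simp] theorem height_shift (j : ℤ) (u : FreeGroup Bool) : height (shift j u) = height u := by
  simp [shift]

theorem norm_shift_le {j : ℤ} {u : FreeGroup Bool} {m n : ℕ} (hj : j.natAbs ≤ m)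
    (hu : u.norm ≤ n) : (shift j u).norm ≤ 2 * m + n := by
  have h1 := norm_of_zpow_le false j
  have h2 := FreeGroup.norm_mul_le (FreeGroup.of false ^ j * u) (FreeGroup.of false ^ j)⁻¹
  have h3 := FreeGroup.norm_mul_le (FreeGroup.of false ^ j) u
  rw [FreeGroup.norm_inv_eq] at h2
  unfold shift
  omega

theorem map_shift {G : Type*} [Group G] (φ : FreeGroup Bool →* G) (j : ℤ) (u : FreeGroup Bool) :
    φ (shift j u) = φ (FreeGroup.of false) ^ j * φ u * (φ (FreeGroup.of false) ^ j)⁻¹ := by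
  simp [shift]

end ExponentSum

/-! ### Pushing words around -/

section Pushing

variable {α : Type*} {R : Set (Word α)}

/-- Let `P` and `W` be families whose words are to be interchanged, and let `q` be the first member
of `W`.  If each `P' i = q * P i` commutes with each member of `W`, then a word in `P` moves past
a word in `W` at quadratic cost, at the price of conjugating the latter by a power of `q`. -/
theorem near_mul_shift {K n : ℕ} {W P P' : FreeGroup Bool →* FreeGroup α}
    (hP : ∀ i, P (FreeGroup.of i) = (W (FreeGroup.of false))⁻¹ * P' (FreeGroup.of i))
    (hW : ∀ i j, NearlyCommute R K (W (FreeGroup.of i)) (P' (FreeGroup.of j)))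
    {u w : FreeGroup Bool} (hu : u.norm ≤ n) (hw : w.norm ≤ n) :
    Near R (7 * K * n ^ 2) (W w * P u) (P u * W (shift (height u) w)) := by
  set q := W (FreeGroup.of false)
  have h1 : Near R (2 * K * n ^ 2) (P u) (q⁻¹ ^ height u * P' u) := by
    have := near_mul_map (R := R) (K := K) (φ := P) (ψ := FreeGroup.lift fun _ => q⁻¹) (θ := P')
      (fun i => Near.of_eq K (by simp [hP i]))
      (fun i j => by simpa using (hW false i).symm.inv_right) hu
    rwa [lift_const] at this
  have h2 : NearlyCommute R (K * (3 * n) * n) (W (shift (height u) w)) (P' u) := by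
    refine (nearlyCommute_map_map hW _ u).mono ?_
    have : (shift (height u) w).norm ≤ 3 * n :=
      (norm_shift_le (natAbs_height_le u) hw).trans (by omega)
    gcongr
  have e : W w * (q⁻¹ ^ height u * P' u) = q⁻¹ ^ height u * (W (shift (height u) w) * P' u) := by
    rw [map_shift, inv_zpow]
    simp [mul_assoc, q]
  have h3 : Near R _ (W w * P u) (q⁻¹ ^ height u * (P' u * W (shift (height u) w))) :=
    (h1.mul_left (W w)).trans (e ▸ h2.mul_left _)
  rw [← mul_assoc (q⁻¹ ^ height u)] at h3
  exact (h3.trans (h1.symm.mul_right _)).mono (le_of_eq (by ring))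

/-- If the quotients of two families are all the same element `q`, and `q` commutes with the second
family, then the families agree, up to quadratic cost, on the words of exponent sum zero. -/
theorem near_of_height_eq_zero {K n : ℕ} {W W' : FreeGroup Bool →* FreeGroup α} {q : FreeGroup α}
    (hq : ∀ i, Near R K (W (FreeGroup.of i)) (W' (FreeGroup.of i) * q))
    (hc : ∀ i, NearlyCommute R K q (W' (FreeGroup.of i))) {w : FreeGroup Bool}
    (hw : w.norm ≤ n) (h0 : height w = 0) : Near R (2 * K * n ^ 2) (W w) (W' w) := by
  have := near_mul_map (R := R) (K := K) (φ := W) (ψ := W') (θ := FreeGroup.lift fun _ => q)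
      (fun i => by simpa using hq i) (fun i j => by simpa using hc j) hw
  rwa [lift_const, h0, zpow_zero, mul_one] at this

end Pushing

/-! ### Normal forms in Stallings' group -/

section NormalForm

open FreeGroup (of)

theorem nearlyCommute_of_conjWord {x y : Gen} (h : conjWord x y ∈ stallingsRelators) :
    NearlyCommute stallingsRelators 1 (of .s) (of x * (of y)⁻¹) := by
  have h1 : Near stallingsRelators 1
      ((of x)⁻¹ * of .s * of x * (of y)⁻¹ * (of .s)⁻¹ * of y) 1 := by
    rw [Near, inv_one, mul_one]
    exact Fillable.of_mem h
  have h2 := (h1.mul_left (of x)).mul_right ((of y)⁻¹ * of .s)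
  simpa [NearlyCommute, mul_assoc] using h2

/-- The lift `x ↦ x * ε⁻¹` of the first factor `F(α, β)`. -/
def pushFirst : FreeGroup Bool →* FreeGroup Gen :=
  FreeGroup.lift fun i => if i then (of .b)⁻¹ else (of .a)⁻¹

/-- The lift `x ↦ x * ε⁻¹` of the second factor `F(γ, δ)`. -/
def pushSecond : FreeGroup Bool →* FreeGroup Gen :=
  FreeGroup.lift fun i => if i then (of .d)⁻¹ else (of .c)⁻¹

/-- For `x = a` this is the lift `y ↦ y * α⁻¹` of the third factor `F(ε, ζ)`, and for `x = c` it is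
the lift `y ↦ y * γ⁻¹`. -/
def pushThird (x : Gen) : FreeGroup Bool →* FreeGroup Gen :=
  FreeGroup.lift fun i => if i then of .s * of x else of x

/-- The normal form `U V W` of an element `(p, q, r)` of Stallings' group: `U` and `V` are the
lifts of `p` and `q`, and `W` is the lift of the word that is obtained from `r` by multiplying it
on the left by the power of `ε` that makes its exponent sum zero. The formula makes sense on the
whole product of free groups, but its value represents `(p, q, r)` only if the exponent sums of
`p`, `q` and `r` add up to zero. -/
def normalForm (g : FreeGroup Bool × FreeGroup Bool × FreeGroup Bool) : FreeGroup Gen :=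
  pushFirst g.1 * pushSecond g.2.1 * pushThird .a (of false ^ (-height g.2.2) * g.2.2)

theorem nearlyCommute_pushFirst_pushSecond (u v : FreeGroup Bool) :
    NearlyCommute stallingsRelators (u.norm * v.norm) (pushFirst u) (pushSecond v) := by
  have h : ∀ i j, NearlyCommute stallingsRelators 1 (pushFirst (of i)) (pushSecond (of j)) := by
    intro i j
    cases i <;> cases j <;> simp only [pushFirst, pushSecond, FreeGroup.lift_apply_of, if_true,
      Bool.false_eq_true, if_false] <;>
    exact (nearlyCommute_of_commWord
      (by simp [stallingsRelators])).inv_right.symm.inv_right.symm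
  simpa using nearlyCommute_map_map h u v

/-- On words of exponent sum zero the choice of the letter with which the third factor is lifted
does not matter, because `a * c⁻¹` commutes with `c` and `s`. -/
theorem near_pushThird {n : ℕ} {w : FreeGroup Bool} (hw : w.norm ≤ n) (h0 : height w = 0) :
    Near stallingsRelators (4 * n ^ 2) (pushThird .a w) (pushThird .c w) := by
  have hac : NearlyCommute stallingsRelators 1 (of .a) (of .c) :=
    nearlyCommute_of_commWord (by simp [stallingsRelators])
  have hq : NearlyCommute stallingsRelators 1 (of .c) (of .a * (of .c)⁻¹) := by
    have := (hac.symm.mul_right (k := (of .c)⁻¹) (Near.of_eq 0 (by group)))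
    simpa using this
  have hs : NearlyCommute stallingsRelators 1 (of .s) (of .a * (of .c)⁻¹) :=
    nearlyCommute_of_conjWord (by simp [stallingsRelators])
  have ha : Near stallingsRelators 1 (of .a) (of .c * (of .a * (of .c)⁻¹)) := by
    simpa using Near.symm hq
  refine near_of_height_eq_zero (K := 2) (q := of .a * (of .c)⁻¹) ?_ ?_ hw h0
  · rintro (_ | _)
    · simpa [pushThird] using ha.mono (Nat.le_succ 1)
    · simpa [pushThird, mul_assoc] using (ha.mul_left (of .s)).mono (Nat.le_succ 1)
  · rintro (_ | _)
    · exact hq.symm.mono (Nat.le_succ 1)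
    · exact hs.symm.mul_right hq.symm

/-- `c * a⁻¹` and `c * b⁻¹`, which lift `α * γ⁻¹` and `β * γ⁻¹`, commute with the lifts `c` and
`s * c` of `ε * γ⁻¹` and `ζ * γ⁻¹`. -/
theorem near_pushThird_mul_pushFirst {n : ℕ} {u w : FreeGroup Bool} (hu : u.norm ≤ n)
    (hw : w.norm ≤ n) : Near stallingsRelators (14 * n ^ 2) (pushThird .c w * pushFirst u)
      (pushFirst u * pushThird .c (shift (height u) w)) := by
  have comm : ∀ {x : Gen}, commWord x .c ∈ stallingsRelators →
      NearlyCommute stallingsRelators 1 (of .c) (of .c * (of x)⁻¹) := by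
    intro x hx
    have h := (nearlyCommute_of_commWord hx).symm.inv_right
    have h' := NearlyCommute.mul_right (h := of Gen.c) (Near.refl 0 _) h
    rwa [zero_add] at h'
  have conj : ∀ {x : Gen}, conjWord x .c ∈ stallingsRelators →
      NearlyCommute stallingsRelators 1 (of .s) (of .c * (of x)⁻¹) := by
    intro x hx
    simpa using (nearlyCommute_of_conjWord hx).inv_right
  refine near_mul_shift (K := 2) (W := pushThird .c) (P := pushFirst)
    (P' := FreeGroup.lift fun i => if i then of .c * (of .b)⁻¹ else of .c * (of .a)⁻¹)
    ?_ ?_ hu hw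
  · rintro (_ | _) <;> simp [pushFirst, pushThird]
  · rintro (_ | _) (_ | _) <;> simp only [pushThird, FreeGroup.lift_apply_of, if_true,
      Bool.false_eq_true, if_false]
    · exact (comm (by simp [stallingsRelators])).mono (Nat.le_succ 1)
    · exact (comm (by simp [stallingsRelators])).mono (Nat.le_succ 1)
    · exact ((conj (by simp [stallingsRelators])).symm.mul_right
        (comm (by simp [stallingsRelators])).symm).symm
    · exact ((conj (by simp [stallingsRelators])).symm.mul_right
        (comm (by simp [stallingsRelators])).symm).symm

/-- `a * c⁻¹` and `a * d⁻¹`, which lift `γ * α⁻¹` and `δ * α⁻¹`, commute with the lifts `a` and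
`s * a` of `ε * α⁻¹` and `ζ * α⁻¹`. -/
theorem near_pushThird_mul_pushSecond {n : ℕ} {v w : FreeGroup Bool} (hv : v.norm ≤ n)
    (hw : w.norm ≤ n) : Near stallingsRelators (14 * n ^ 2) (pushThird .a w * pushSecond v)
      (pushSecond v * pushThird .a (shift (height v) w)) := by
  have comm : ∀ {x : Gen}, commWord .a x ∈ stallingsRelators →
      NearlyCommute stallingsRelators 1 (of .a) (of .a * (of x)⁻¹) := by
    intro x hx
    have h := (nearlyCommute_of_commWord hx).inv_right
    have h' := NearlyCommute.mul_right (h := of Gen.a) (Near.refl 0 _) h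
    rwa [zero_add] at h'
  refine near_mul_shift (K := 2) (W := pushThird .a) (P := pushSecond)
    (P' := FreeGroup.lift fun i => if i then of .a * (of .d)⁻¹ else of .a * (of .c)⁻¹)
    ?_ ?_ hv hw
  · rintro (_ | _) <;> simp [pushSecond, pushThird]
  · rintro (_ | _) (_ | _) <;> simp only [pushThird, FreeGroup.lift_apply_of, if_true,
      Bool.false_eq_true, if_false]
    · exact (comm (by simp [stallingsRelators])).mono (Nat.le_succ 1)
    · exact (comm (by simp [stallingsRelators])).mono (Nat.le_succ 1)
    · exact ((nearlyCommute_of_conjWord (by simp [stallingsRelators])).symm.mul_right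
        (comm (by simp [stallingsRelators])).symm).symm
    · exact ((nearlyCommute_of_conjWord (by simp [stallingsRelators])).symm.mul_right
        (comm (by simp [stallingsRelators])).symm).symm

theorem mem_stallingsGroup_iff {g : FreeGroup Bool × FreeGroup Bool × FreeGroup Bool} :
    g ∈ stallingsGroup ↔ height g.1 + height g.2.1 + height g.2.2 = 0 := by
  rw [stallingsGroup, MonoidHom.mem_ker, ← Multiplicative.toAdd.injective.eq_iff]
  simp [height, add_assoc]

/-- Stallings' group is the semidirect product of the lift of the first two free factors and the
kernel of the exponent sum on the third: the third parts of normal forms can be moved past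
the other parts at the price of a conjugation by a power of `ε`, so a product of two normal
forms is brought to normal form at quadratic cost. -/
theorem near_normalForm_mul {n : ℕ}
    {g g' : FreeGroup Bool × FreeGroup Bool × FreeGroup Bool} (hg' : g' ∈ stallingsGroup)
    (h1 : g.2.1.norm ≤ n) (h2 : g.2.2.norm ≤ n) (h3 : g'.1.norm ≤ n) (h4 : g'.2.1.norm ≤ n) :
    Near stallingsRelators (361 * n ^ 2) (normalForm g * normalForm g') (normalForm (g * g')) := by
  obtain ⟨p, q, r⟩ := g
  obtain ⟨p', q', r'⟩ := g'
  simp only at h1 h2 h3 h4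
  rw [mem_stallingsGroup_iff] at hg'
  simp only at hg'
  simp only [normalForm, Prod.mk_mul_mk]
  set w := of false ^ (-height r) * r with hw
  have hw0 : height w = 0 := by simp [w]
  have hwn : w.norm ≤ 2 * n := by
    have := FreeGroup.norm_mul_le (of false ^ (-height r)) r
    have := norm_of_zpow_le false (-height r)
    have := natAbs_height_le r
    rw [hw]
    omega
  set w₁ := shift (height p') w with hw₁
  have hw₁n : w₁.norm ≤ 4 * n :=
    (norm_shift_le ((natAbs_height_le p').trans h3) hwn).trans (by omega)
  set w₂ := shift (height q') w₁ with hw₂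
  have hw₁0 : height w₁ = 0 := by rw [hw₁, height_shift, hw0]
  -- `W` passes the first part when it is lifted with `γ`, and the second when it is lifted with `α`
  have s1 := near_pushThird hwn hw0
  have s2 := near_pushThird_mul_pushFirst (h3.trans (by omega : n ≤ 2 * n)) hwn
  have s3 := near_pushThird hw₁n hw₁0
  have s4 := near_pushThird_mul_pushSecond (h4.trans (by omega : n ≤ 4 * n)) hw₁n
  rw [← hw₂] at s4
  have s5 : NearlyCommute stallingsRelators (n * n) (pushFirst p') (pushSecond q) :=
    (nearlyCommute_pushFirst_pushSecond p' q).mono (Nat.mul_le_mul h3 h1)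
  have t1 : Near stallingsRelators _ (pushThird .a w * pushFirst p')
      (pushFirst p' * pushThird .a w₁) :=
    ((s1.mul_right _).trans s2).trans (s3.symm.mul_left _)
  have t2 := (t1.mul_right (pushSecond q')).trans
    (((Near.of_eq 0 (mul_assoc _ _ _)).trans (s4.mul_left (pushFirst p'))))
  set w' := of false ^ (-height r') * r' with hw'
  have e : w₂ * w' = of false ^ (-height (r * r')) * (r * r') := by
    have hj : height r' = -(height p' + height q') := by omega
    rw [hw₂, hw₁, hw, hw', height_mul, hj]
    simp only [shift]
    group
  have t3 := ((t2.mul_right (pushThird .a w')).mul_left (pushFirst p * pushSecond q)).trans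
    ((Near.of_eq 0 (by simp only [mul_assoc])).trans
      ((s5.symm.mul_left (pushFirst p)).mul_right
        (pushSecond q' * (pushThird .a w₂ * pushThird .a w'))))
  rw [← e]
  simp only [map_mul]
  simp only [mul_assoc] at t3 ⊢
  refine t3.mono ?_
  nlinarith

theorem normalForm_letter (x : Gen × Bool) :
    normalForm (FreeGroup.lift genValue (FreeGroup.mk [x])) = FreeGroup.mk [x] := by
  have hneg : ∀ y : Gen, FreeGroup.mk [(y, false)] = (of y)⁻¹ := fun _ => rfl
  have hpos : ∀ y : Gen, FreeGroup.mk [(y, true)] = of y := fun _ => rfl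
  obtain ⟨y, _ | _⟩ := x <;> cases y <;>
    simp [hneg, hpos, genValue, normalForm, pushFirst, pushSecond, pushThird]

theorem norm_lift_genValue_le (L : Word Gen) :
    (FreeGroup.lift genValue (FreeGroup.mk L)).1.norm ≤ 2 * L.length ∧
    (FreeGroup.lift genValue (FreeGroup.mk L)).2.1.norm ≤ 2 * L.length ∧
    (FreeGroup.lift genValue (FreeGroup.mk L)).2.2.norm ≤ 2 * L.length := by
  induction L with
  | nil => simp [← FreeGroup.one_eq_mk]
  | cons x L ih =>
    have hts : (of true * (of false)⁻¹ : FreeGroup Bool).norm ≤ 2 := by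
      simpa using FreeGroup.norm_mul_le (of true) (of false)⁻¹
    have hts' : (of false * (of true)⁻¹ : FreeGroup Bool).norm ≤ 2 := by
      simpa using FreeGroup.norm_mul_le (of false) (of true)⁻¹
    have hx : (FreeGroup.lift genValue (FreeGroup.mk [x])).1.norm ≤ 2 ∧
        (FreeGroup.lift genValue (FreeGroup.mk [x])).2.1.norm ≤ 2 ∧
        (FreeGroup.lift genValue (FreeGroup.mk [x])).2.2.norm ≤ 2 := by
      obtain ⟨y, _ | _⟩ := x <;> cases y <;> simp [genValue, hts, hts']
    have e : FreeGroup.mk (x :: L) = FreeGroup.mk [x] * FreeGroup.mk L := by simp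
    rw [e, map_mul, List.length_cons]
    have m1 := FreeGroup.norm_mul_le (FreeGroup.lift genValue (FreeGroup.mk [x])).1
      (FreeGroup.lift genValue (FreeGroup.mk L)).1
    have m2 := FreeGroup.norm_mul_le (FreeGroup.lift genValue (FreeGroup.mk [x])).2.1
      (FreeGroup.lift genValue (FreeGroup.mk L)).2.1
    have m3 := FreeGroup.norm_mul_le (FreeGroup.lift genValue (FreeGroup.mk [x])).2.2
      (FreeGroup.lift genValue (FreeGroup.mk L)).2.2
    simp only [Prod.fst_mul, Prod.snd_mul]
    omega

theorem coe_lift_stallingsGen (g : FreeGroup Gen) :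
    ((FreeGroup.lift stallingsGen g : stallingsGroup) :
      FreeGroup Bool × FreeGroup Bool × FreeGroup Bool) = FreeGroup.lift genValue g := by
  have : stallingsGroup.subtype.comp (FreeGroup.lift stallingsGen) =
      FreeGroup.lift genValue := by
    ext1 x; simp [stallingsGen]
  exact DFunLike.congr_fun this g

theorem lift_genValue_mem (g : FreeGroup Gen) : FreeGroup.lift genValue g ∈ stallingsGroup :=
  coe_lift_stallingsGen g ▸ (FreeGroup.lift stallingsGen g).2

/-- Every word is brought to normal form at quadratic cost: halve it, bring both halves to normal
form, and multiply.  Up to a constant the multiplications cost `n² + 2 (n/2)² + 4 (n/4)² + ⋯`, which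
is at most `2 n²`. -/
theorem near_normalForm (L : Word Gen) : Near stallingsRelators (4000 * L.length ^ 2)
    (FreeGroup.mk L) (normalForm (FreeGroup.lift genValue (FreeGroup.mk L))) := by
  induction hn : L.length using Nat.strong_induction_on generalizing L with
  | _ n ih =>
    match L, hn with
    | [], _ => exact Near.of_eq _ (by simp [← FreeGroup.one_eq_mk, normalForm])
    | [x], _ => exact Near.of_eq _ (normalForm_letter x).symm
    | x :: y :: L', hn =>
      set L := x :: y :: L' with hL
      have hn2 : 2 ≤ n := by rw [← hn, hL]; simp
      set A := L.take (n / 2) with hA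
      set B := L.drop (n / 2) with hB
      have hAl : A.length = n / 2 := by rw [hA, List.length_take]; omega
      have hBl : B.length = n - n / 2 := by rw [hB, List.length_drop]; omega
      have e : FreeGroup.mk L = FreeGroup.mk A * FreeGroup.mk B := by
        rw [FreeGroup.mul_mk, List.take_append_drop]
      have iA := ih _ (by omega) A hAl
      have iB := ih _ (by omega) B hBl
      obtain ⟨-, a2, a3⟩ := norm_lift_genValue_le A
      obtain ⟨b1, b2, -⟩ := norm_lift_genValue_le B
      -- the bound `n + 1` allows for the longer half of a word of odd length, as its image has
      -- coordinates of length at most `2 * (n - n / 2)`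
      have hm := near_normalForm_mul (n := n + 1) (lift_genValue_mem (FreeGroup.mk B))
        (a2.trans (by omega)) (a3.trans (by omega)) (b1.trans (by omega)) (b2.trans (by omega))
      rw [← map_mul, ← e] at hm
      have := (iA.mul iB).trans hm
      rw [← e] at this
      refine this.mono ?_
      rcases Nat.even_or_odd' n with ⟨k, rfl | rfl⟩
      · rw [show 2 * k / 2 = k by omega, show 2 * k - k = k by omega]
        nlinarith
      · rw [show (2 * k + 1) / 2 = k by omega, show 2 * k + 1 - k = k + 1 by omega]
        nlinarith

end NormalForm

/-! ### The presentation and its Dehn function -/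

section Conclusion

open FreeGroup (of)

theorem lift_genValue_normalForm {g : FreeGroup Bool × FreeGroup Bool × FreeGroup Bool}
    (hg : g ∈ stallingsGroup) : FreeGroup.lift genValue (normalForm g) = g := by
  have e1 : ∀ u, FreeGroup.lift genValue (pushFirst u) = (u, 1, (of false)⁻¹ ^ height u) := by
    intro u
    have : (FreeGroup.lift genValue).comp pushFirst = (MonoidHom.id _).prod
        ((1 : FreeGroup Bool →* FreeGroup Bool).prod (FreeGroup.lift fun _ => (of false)⁻¹)) := by
      ext1 i; cases i <;> simp [pushFirst, genValue]
    simpa [lift_const] using DFunLike.congr_fun this u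
  have e2 : ∀ u, FreeGroup.lift genValue (pushSecond u) = (1, u, (of false)⁻¹ ^ height u) := by
    intro u
    have : (FreeGroup.lift genValue).comp pushSecond = (1 : FreeGroup Bool →* FreeGroup Bool).prod
        ((MonoidHom.id _).prod (FreeGroup.lift fun _ => (of false)⁻¹)) := by
      ext1 i; cases i <;> simp [pushSecond, genValue]
    simpa [lift_const] using DFunLike.congr_fun this u
  have e3 : ∀ u, FreeGroup.lift genValue (pushThird .a u) = ((of false)⁻¹ ^ height u, 1, u) := by
    intro u
    have : (FreeGroup.lift genValue).comp (pushThird .a) =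
        (FreeGroup.lift fun _ => (of false)⁻¹).prod
          ((1 : FreeGroup Bool →* FreeGroup Bool).prod (MonoidHom.id _)) := by
      ext1 i; cases i <;> simp [pushThird, genValue]
    simpa [lift_const] using DFunLike.congr_fun this u
  obtain ⟨p, q, r⟩ := g
  rw [mem_stallingsGroup_iff] at hg
  simp only at hg
  have hr : height r = -(height p + height q) := by omega
  simp only [normalForm, map_mul, e1, e2, e3, Prod.mk_mul_mk, height_zpow, height_of, hr]
  refine Prod.ext ?_ (Prod.ext ?_ ?_)
  · simp only
    group
  · simp
  · simp only
    group

/-- The upper bound, with the fact that the ten relators define Stallings' group: the normal form of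
the identity is empty. -/
theorem fillable_of_lift_eq_one {L : Word Gen}
    (h : FreeGroup.lift stallingsGen (FreeGroup.mk L) = 1) :
    Fillable stallingsRelators (4000 * L.length ^ 2) (FreeGroup.mk L) := by
  have h1 := near_normalForm L
  rw [← coe_lift_stallingsGen, h, OneMemClass.coe_one] at h1
  have h2 : normalForm 1 = 1 := by simp [normalForm]
  rwa [h2, Near, inv_one, mul_one] at h1

theorem isPresentation_stallingsRelators :
    IsPresentation stallingsRelators stallingsGen := by
  refine ⟨fun g => ⟨normalForm g, Subtype.ext ?_⟩, le_antisymm (fun g hg => ?_) ?_⟩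
  · rw [coe_lift_stallingsGen, lift_genValue_normalForm g.2]
  · obtain ⟨L, rfl⟩ : ∃ L, FreeGroup.mk L = g := Quot.exists_rep g
    exact (fillable_of_lift_eq_one (MonoidHom.mem_ker.1 hg)).mem_normalClosure
  · refine Subgroup.normalClosure_le_normal ?_
    rintro _ ⟨r, hr, rfl⟩
    rw [SetLike.mem_coe, MonoidHom.mem_ker, Subtype.ext_iff, coe_lift_stallingsGen]
    simp only [stallingsRelators, Set.mem_insert_iff, Set.mem_singleton_iff] at hr
    rcases hr with rfl | rfl | rfl | rfl | rfl | rfl | rfl | rfl | rfl | rfl <;>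
      simp [commWord, conjWord, genValue, mul_assoc]

theorem area_le_sq {w : Word Gen} (hw : NullHomotopic stallingsRelators w) :
    area stallingsRelators w ≤ 4000 * w.length ^ 2 := by
  have hk : FreeGroup.mk w ∈ (FreeGroup.lift stallingsGen).ker := by
    rw [isPresentation_stallingsRelators.2]; exact hw
  exact (fillable_of_lift_eq_one (MonoidHom.mem_ker.1 hk)).area_le

theorem equivalent_stallingsRelators :
    Equivalent (dehnFunction stallingsRelators) (fun n => n ^ 2) := by
  refine ⟨⟨4000, by norm_num, fun n => ?_⟩, ⟨4, by norm_num, fun n => ?_⟩⟩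
  · refine dehnFunction_le fun w hw hn => (area_le_sq hw).trans ?_
    have : w.length ^ 2 ≤ (4000 * n + 4000) ^ 2 := Nat.pow_le_pow_left (by omega) 2
    simp only
    omega
  · have h1 := sq_le_dehnFunction n
    have h2 := dehnFunction_mono stallingsRelators (by omega : 4 * n ≤ 4 * n + 4)
    simp only
    omega

end Conclusion

end Stallings

theorem theorem1 :
    -- the presentation on `a, b, c, d, s` presents Stallings' group
    Stallings.IsPresentation Stallings.stallingsRelators Stallings.stallingsGen ∧
    -- its Dehn function is quadratic
    Stallings.Equivalent (Stallings.dehnFunction Stallings.stallingsRelators) (fun n => n ^ 2) ∧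
    -- the Dehn function of every finite presentation of Stallings' group is quadratic
    ∀ (α : Type*) [Finite α] (R : Set (Stallings.Word α)) (f : α → Stallings.stallingsGroup),
      R.Finite → Stallings.IsPresentation R f →
        Stallings.Equivalent (Stallings.dehnFunction R) (fun n => n ^ 2) := by
  refine ⟨Stallings.isPresentation_stallingsRelators, Stallings.equivalent_stallingsRelators,
    fun α _ R f hR hf => ⟨?_, ?_⟩⟩
  · exact (hf.dominated Stallings.isPresentation_stallingsRelators
      Stallings.finite_stallingsRelators).trans (fun _ _ h => Nat.pow_le_pow_left h 2)
      Stallings.equivalent_stallingsRelators.1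
  · exact Stallings.equivalent_stallingsRelators.2.trans (Stallings.dehnFunction_mono R)
      (Stallings.isPresentation_stallingsRelators.dominated hf hR)
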